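/- Let $\mathcal G=(V,\mathcal E,W)$ be a strongly connected directed graph with nodes $V=\{1,\dots,n\}$ (self-loops allowed) and integer travel times $w_{ij}\ge 1$ for $(i,j)\in\mathcal E$, $w_{ij}=0$ for $(i,j)\notin\mathcal E$ (the case $w_{ij}=1$ on all edges is the case of unitary travel times). Let $\pi\in\mathbb R^n$ satisfy $\pi_i>0$ for all $i$ and $\sum_i\pi_i=1$, let $\varepsilon>0$, and let $$\mathcal P=\{P\in\mathbb R^{n\times n} : p_{ij}\ge\varepsilon \text{ if } (i,j)\in\mathcal E,\ p_{ij}=0 \text{ if } (i,j)\notin\mathcal E,\ P\mathbf 1=\mathbf 1,\ \pi^\top P=\pi^\top\}$$ be the set of $\varepsilon$-conforming transition matrices. For $P\in\mathcal P$ let $(X_k)_{k\ge 0}$ be the Markov chain with transition matrix $P$, let $T_{ii}=\min\{\sum_{m=0}^{k-1}w_{X_mX_{m+1}} : k\ge 1,\ X_k=i\}$, given $X_0=i$, be the return time of node $i$, and set (natural logarithm, $0\log 0=0$) $$\mathbb H(T_{ii})=-\sum_{k=1}^\infty \mathbb P(T_{ii}=k)\log\mathbb P(T_{ii}=k),\quad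 \mathbb J(P)=\sum_{i=1}^n\pi_i\,\mathbb H(T_{ii}),\quad \mathbb H_{\rm rate}(P)=-\sum_{i=1}^n\pi_i\sum_{j=1}^n p_{ij}\log p_{ij}.$$ A first return path of a node $i$ is a path in $\mathcal G$ from $i$ to $i$ with at least one edge and no intervening node equal to $i$; its length is the sum of the travel times of its edges. Then: (i) for all $P\in\mathcal P$ the series defining the $\mathbb H(T_{ii})$ converge, and $\mathbb J(P)\le n\,\mathbb H_{\rm rate}(P)$; (ii) for each $P\in\mathcal P$, the equality $\mathbb J(P)=n\,\mathbb H_{\rm rate}(P)$ holds if and only if, for every node of $\mathcal G$, all distinct first return paths of that node have different lengths; and if $\mathcal G$ has this property, then $$\operatorname*{arg\,max}_{P\in\mathcal P}\mathbb J(P)=\operatorname*{arg\,max}_{P\in\mathcal P}\mathbb H_{\rm rate}(P)$$ (equality of the sets of maximizers). -/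

import Mathlib

open MeasureTheory ProbabilityTheory
open scoped Matrix

/-- A directed graph on the nodes `Fin n` (self-loops allowed) with integer travel times: `w i j` is
the one-hop travel time from `i` to `j`, at least one on edges and zero off the edges. -/
structure WeightedDigraph (n : ℕ) extends Digraph (Fin n) where
  w : Matrix (Fin n) (Fin n) ℕ
  one_le_w : ∀ i j, Adj i j → 1 ≤ w i j
  w_eq_zero : ∀ i j, ¬ Adj i j → w i j = 0

namespace WeightedDigraph

variable {n : ℕ}

/-- Every node can be reached from every node along directed edges. -/
def StronglyConnected (G : WeightedDigraph n) : Prop :=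
  ∀ i j : Fin n, Relation.ReflTransGen G.Adj i j

/-- A first return path of the node `i`: a path of the graph, given by the list of its nodes, that
starts and ends at `i` and has no intervening node equal to `i`. -/
def IsFirstReturnPath (G : WeightedDigraph n) (i : Fin n) (p : List (Fin n)) : Prop :=
  ∃ l : List (Fin n), p = i :: (l ++ [i]) ∧ i ∉ l ∧ p.IsChain G.Adj

/-- The length (total travel time) of a path given by the list of its nodes. -/
def pathLength (G : WeightedDigraph n) : List (Fin n) → ℕ
  | a :: b :: l => G.w a b + G.pathLength (b :: l)
  | _ => 0

/-- For every node, distinct first return paths have different lengths. -/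
def ReturnPathsDistinguishable (G : WeightedDigraph n) : Prop :=
  ∀ (i : Fin n) (p q : List (Fin n)), G.IsFirstReturnPath i p → G.IsFirstReturnPath i q →
    p ≠ q → G.pathLength p ≠ G.pathLength q

/-- The set of (transition matrices of) Markov chains that are `ε`-conforming to `G`, with
stationary distribution `π`. -/
def conforming (G : WeightedDigraph n) (π : Fin n → ℝ) (ε : ℝ) :
    Set (Matrix (Fin n) (Fin n) ℝ) :=
  {P | (∀ i j, G.Adj i j → ε ≤ P i j) ∧ (∀ i j, ¬ G.Adj i j → P i j = 0) ∧
    P *ᵥ 1 = 1 ∧ π ᵥ* P = π}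

/-- The first hitting time of `j` by the walk `x 0, x 1, x 2, …`: the least total travel time
of the first `k` steps over all `k ≥ 1` with `x k = j`, and `⊤` if there is no such `k`. -/
noncomputable def hittingTime (G : WeightedDigraph n) (j : Fin n) (x : ℕ → Fin n) : ℕ∞ :=
  sInf {t : ℕ∞ | ∃ k : ℕ, 1 ≤ k ∧ x k = j ∧
    t = ((∑ m ∈ Finset.range k, G.w (x m) (x (m + 1)) : ℕ) : ℕ∞)}

end WeightedDigraph

section MarkovChain

variable {n : ℕ}

open Classical in
/-- The law of the next state given that the current state is `i`: it charges `j` with the mass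
`P i j`. If `P` is not row-stochastic, the value is a placeholder (the walk stays at `i`). -/
noncomputable def nextState (P : Matrix (Fin n) (Fin n) ℝ) (i : Fin n) : PMF (Fin n) :=
  if h : (∀ i j, 0 ≤ P i j) ∧ P *ᵥ 1 = 1 then
    PMF.ofFintype (fun j => ENNReal.ofReal (P i j)) (by
      rw [← ENNReal.ofReal_sum_of_nonneg fun j _ => h.1 i j]
      have := congrFun h.2 i
      simp only [Matrix.mulVec, dotProduct, Pi.one_apply, mul_one] at this
      rw [this, ENNReal.ofReal_one])
  else PMF.pure i

/-- The one-step kernel of the Markov chain with transition matrix `P`. -/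
noncomputable def stepKernel (P : Matrix (Fin n) (Fin n) ℝ) : Kernel (Fin n) (Fin n) :=
  Kernel.ofFunOfCountable fun i => (nextState P i).toMeasure

instance (P : Matrix (Fin n) (Fin n) ℝ) : IsMarkovKernel (stepKernel P) :=
  ⟨fun i => PMF.toMeasure.isProbabilityMeasure (nextState P i)⟩

/-- The one-step kernel, seen as a kernel from the history up to time `m` to the state at time
`m + 1`; it depends on the history through the state at time `m` only. -/
noncomputable def historyKernel (P : Matrix (Fin n) (Fin n) ℝ) (m : ℕ) :
    Kernel ((k : Finset.Iic m) → Fin n) (Fin n) :=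
  (stepKernel P).comap (fun x => x ⟨m, Finset.mem_Iic.2 le_rfl⟩) (measurable_pi_apply _)

instance (P : Matrix (Fin n) (Fin n) ℝ) (m : ℕ) : IsMarkovKernel (historyKernel P m) :=
  inferInstanceAs (IsMarkovKernel ((stepKernel P).comap _ _))

/-- The law on trajectories of the time-homogeneous Markov chain with transition matrix `P`
started at `X 0 = i`, built from the one-step kernels by the Ionescu-Tulcea theorem. -/
noncomputable def markovLaw (P : Matrix (Fin n) (Fin n) ℝ) (i : Fin n) : Measure (ℕ → Fin n) :=
  Kernel.traj (X := fun _ => Fin n) (historyKernel P) 0 (fun _ => i)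

/-- The entropy rate of the Markov chain with transition matrix `P` and stationary
distribution `π`. -/
noncomputable def entropyRate (π : Fin n → ℝ) (P : Matrix (Fin n) (Fin n) ℝ) : ℝ :=
  -∑ i, π i * ∑ j, P i j * Real.log (P i j)

/-- The set of maximizers of `f` over `S`. -/
def argmaxOn (f : Matrix (Fin n) (Fin n) ℝ → ℝ) (S : Set (Matrix (Fin n) (Fin n) ℝ)) :
    Set (Matrix (Fin n) (Fin n) ℝ) :=
  {P | P ∈ S ∧ ∀ Q ∈ S, f Q ≤ f P}

end MarkovChain

namespace WeightedDigraph

variable {n : ℕ}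

/-- The first hitting time probability `ℙ(T_{ij} = k)`. -/
noncomputable def hittingProb (G : WeightedDigraph n) (P : Matrix (Fin n) (Fin n) ℝ) (k : ℕ)
    (i j : Fin n) : ℝ :=
  (markovLaw P i).real {x | G.hittingTime j x = (k : ℕ∞)}

/-- The terms `-ℙ(T_{ii} = k) log ℙ(T_{ii} = k)`, `k ≥ 1`, of the return time entropy of the
state `i`; the index is shifted by one. -/
noncomputable def returnTimeEntropyTerm (G : WeightedDigraph n) (P : Matrix (Fin n) (Fin n) ℝ)
    (i : Fin n) (k : ℕ) : ℝ :=
  -(G.hittingProb P (k + 1) i i * Real.log (G.hittingProb P (k + 1) i i))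

/-- The return time entropy `ℍ(T_{ii})` of the state `i`. -/
noncomputable def stateReturnTimeEntropy (G : WeightedDigraph n)
    (P : Matrix (Fin n) (Fin n) ℝ) (i : Fin n) : ℝ :=
  ∑' k : ℕ, G.returnTimeEntropyTerm P i k

/-- The return time entropy `𝕁(P) = ∑ᵢ πᵢ ℍ(T_{ii})`. -/
noncomputable def returnTimeEntropy (G : WeightedDigraph n) (π : Fin n → ℝ)
    (P : Matrix (Fin n) (Fin n) ℝ) : ℝ :=
  ∑ i, π i * G.stateReturnTimeEntropy P i

end WeightedDigraph

/-!
Fix a node `i`. A first return path of `i` is encoded by the list `l` of its inner nodes, and its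
probability is `tabooProb P i i l`. Two facts carry the proof.

* The entropy of the first return path of `i` is `entropyRate π P / π i`
  (`hasSum_negMulLog_tabooProb`). Let `E j` be the entropy of the path from `j` up to its first
  visit of `i`. Since `i` is hit almost surely (`tsum_hitTerm_eq_one`), the chain rule gives
  `E j = h j + ∑ k ≠ i, P j k * E k` with `h j` the entropy of the row `j` of `P`. Summing against
  the stationary vector `π` turns the right-hand side into `entropyRate π P + ∑ k ≠ i, π k * E k`,
  so everything but `π i * E i` cancels (`mul_eq_of_taboo_recursion`). Finiteness of `E`, needed for
  the cancellation, comes from the same computation for the series truncated by path length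
  (`mul_le_of_taboo_recursion`). The almost sure return to `i` is the instance of the cancellation
  with hitting probabilities in place of entropies; it spreads to the other nodes by strong
  connectivity.

* The return time is the length of the first return path, so its law arises from the law of that
  path by merging all paths of equal length (`WeightedDigraph.ofReal_hittingProb`). Merging atoms
  does not increase entropy, and preserves it iff no two positive atoms are merged
  (`hasSum_negMulLog_fiberwise`). As `ε`-conforming chains charge every edge, all first return paths
  have positive probability, so equality means that they have different lengths.

Hence `π i * ℍ(T_{ii}) ≤ entropyRate π P` for each of the `n` nodes `i`, and summation over `i` gives
the bound and its equality case. If equality holds on the whole conforming set, the two objectives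
are proportional there with the positive factor `n`, so they have the same maximizers.
-/

/-! ### First-return probabilities of the Markov law -/

section MarkovLaw

variable {n : ℕ}

lemma stepKernel_singleton {P : Matrix (Fin n) (Fin n) ℝ}
    (hP : (∀ i j, 0 ≤ P i j) ∧ P *ᵥ 1 = 1) (i j : Fin n) :
    stepKernel P i {j} = ENNReal.ofReal (P i j) := by
  have h : stepKernel P i = (nextState P i).toMeasure := rfl
  rw [h, PMF.toMeasure_apply_singleton _ _ (measurableSet_singleton j), nextState, dif_pos hP]
  rfl

lemma measurableSet_cylinder_eq (y : ℕ → Fin n) (m : ℕ) :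
    MeasurableSet {x : ℕ → Fin n | ∀ k ≤ m, x k = y k} := by
  have h : {x : ℕ → Fin n | ∀ k ≤ m, x k = y k} = ⋂ k, ⋂ (_ : k ≤ m), {x | x k = y k} := by
    ext x; simp
  rw [h]
  exact .iInter fun k => .iInter fun _ => (measurableSet_singleton (y k)).preimage (measurable_pi_apply k)

lemma preimage_frestrictLe_singleton (y : ℕ → Fin n) (m : ℕ) :
    (Preorder.frestrictLe (π := fun _ => Fin n) m) ⁻¹' {Preorder.frestrictLe m y} =
      {x : ℕ → Fin n | ∀ k ≤ m, x k = y k} := by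
  ext x
  simp only [Set.mem_preimage, Set.mem_singleton_iff, Set.mem_ofPred_eq]
  refine ⟨fun h k hk => congrFun h ⟨k, Finset.mem_Iic.2 hk⟩, fun h => funext fun k => ?_⟩
  exact h k (Finset.mem_Iic.1 k.2)

instance isProbabilityMeasure_markovLaw (P : Matrix (Fin n) (Fin n) ℝ) (i : Fin n) :
    IsProbabilityMeasure (markovLaw P i) := by
  unfold markovLaw; infer_instance

lemma markovLaw_map_frestrictLe (P : Matrix (Fin n) (Fin n) ℝ) (i : Fin n) (m : ℕ) :
    (markovLaw P i).map (Preorder.frestrictLe (π := fun _ => Fin n) m) =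
      Kernel.partialTraj (X := fun _ => Fin n) (historyKernel P) 0 m (fun _ => i) :=
  Kernel.traj_map_frestrictLe_apply 0 m _

/-- The probability that the chain started at `y 0` follows `y` for `m` steps is the product of
the transition probabilities. -/
lemma markovLaw_cylinder {P : Matrix (Fin n) (Fin n) ℝ}
    (hP : (∀ i j, 0 ≤ P i j) ∧ P *ᵥ 1 = 1) (y : ℕ → Fin n) (m : ℕ) :
    markovLaw P (y 0) {x | ∀ k ≤ m, x k = y k} =
      ∏ k ∈ Finset.range m, ENNReal.ofReal (P (y k) (y (k + 1))) := by
  induction m with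
  | zero =>
    rw [← preimage_frestrictLe_singleton, ← Measure.map_apply (by fun_prop)
      (measurableSet_singleton _), markovLaw_map_frestrictLe, Kernel.partialTraj_self,
      Kernel.id_apply, Measure.dirac_apply' _ (measurableSet_singleton _)]
    have h : (fun _ : Finset.Iic 0 => y 0) = Preorder.frestrictLe (π := fun _ => Fin n) 0 y := by
      funext k
      have hk : (k : ℕ) = 0 := Nat.le_zero.1 (Finset.mem_Iic.1 k.2)
      change y 0 = y k
      rw [hk]
    simp [h]
  | succ m ih =>
    have hset : {x : ℕ → Fin n | ∀ k ≤ m + 1, x k = y k} =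
        (fun x => (Preorder.frestrictLe (π := fun _ => Fin n) m x, x (m + 1))) ⁻¹'
          ({Preorder.frestrictLe m y} ×ˢ {y (m + 1)}) := by
      ext x
      rw [Set.mk_preimage_prod, preimage_frestrictLe_singleton]
      constructor
      · exact fun h => ⟨fun k hk => h k (hk.trans m.le_succ), h _ le_rfl⟩
      · rintro ⟨h₁, h₂⟩ k hk
        rcases Nat.le_succ_iff.1 hk with hk | rfl
        exacts [h₁ k hk, h₂]
    rw [hset, ← Measure.map_apply (by fun_prop)
      ((measurableSet_singleton _).prod (measurableSet_singleton _)), markovLaw,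
      ← Kernel.partialTraj_compProd_eq_map_traj (Nat.zero_le m),
      Measure.compProd_apply_prod (measurableSet_singleton _) (measurableSet_singleton _),
      lintegral_singleton, ← markovLaw_map_frestrictLe, Measure.map_apply (by fun_prop)
      (measurableSet_singleton _), preimage_frestrictLe_singleton, ih, Finset.prod_range_succ,
      mul_comm]
    congr 1
    exact stepKernel_singleton hP _ _

end MarkovLaw

section TabooPaths

variable {n : ℕ}

/-- The probability that a chain started at `j` first visits the nodes of `l`, in this order and
all different from `i`, and then `i`. It is zero if `i ∈ l`. -/
def tabooProb (P : Matrix (Fin n) (Fin n) ℝ) (i : Fin n) : Fin n → List (Fin n) → ℝ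
  | j, [] => P j i
  | j, k :: l => if k = i then 0 else P j k * tabooProb P i k l

lemma tabooProb_eq_zero_of_mem (P : Matrix (Fin n) (Fin n) ℝ) {i : Fin n} {l : List (Fin n)}
    (h : i ∈ l) (j : Fin n) : tabooProb P i j l = 0 := by
  induction l generalizing j with
  | nil => simp at h
  | cons k l ih =>
    rw [tabooProb]
    split_ifs with hk
    · rfl
    · rw [ih ((List.mem_cons.1 h).resolve_left (Ne.symm hk)), mul_zero]

/-- The walk that starts at `j`, visits the nodes of `l`, and then stays at `i`. -/
def walkOf (i j : Fin n) (l : List (Fin n)) (k : ℕ) : Fin n := (j :: (l ++ [i])).getD k i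

lemma walkOf_succ_cons (i j a : Fin n) (l : List (Fin n)) (k : ℕ) :
    walkOf i j (a :: l) (k + 1) = walkOf i a l k := by
  simp [walkOf]

@[simp] lemma walkOf_zero (i j : Fin n) (l : List (Fin n)) : walkOf i j l 0 = j := by
  simp [walkOf]

lemma walkOf_succ_of_lt (i j : Fin n) {l : List (Fin n)} {k : ℕ} (hk : k < l.length) :
    walkOf i j l (k + 1) = l[k] := by
  simp [walkOf, List.getElem?_append_left hk, List.getElem?_eq_getElem hk]

@[simp] lemma walkOf_length_succ (i j : Fin n) (l : List (Fin n)) :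
    walkOf i j l (l.length + 1) = i := by
  simp [walkOf]

lemma tabooProb_eq_prod (P : Matrix (Fin n) (Fin n) ℝ) {i : Fin n} {l : List (Fin n)}
    (h : i ∉ l) (j : Fin n) :
    tabooProb P i j l =
      ∏ k ∈ Finset.range (l.length + 1), P (walkOf i j l k) (walkOf i j l (k + 1)) := by
  induction l generalizing j with
  | nil => simp [tabooProb, walkOf]
  | cons a l ih =>
    simp only [List.mem_cons, not_or] at h
    rw [tabooProb, if_neg (Ne.symm h.1), ih h.2, List.length_cons,
      Finset.prod_range_succ' _ (l.length + 1), mul_comm]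
    simp only [walkOf_succ_cons, walkOf_zero]

lemma WeightedDigraph.pathLength_eq_sum (G : WeightedDigraph n) (i : Fin n) (l : List (Fin n))
    (j : Fin n) : G.pathLength (j :: (l ++ [i])) =
      ∑ k ∈ Finset.range (l.length + 1), G.w (walkOf i j l k) (walkOf i j l (k + 1)) := by
  induction l generalizing j with
  | nil => simp [pathLength, walkOf]
  | cons a l ih =>
    rw [List.cons_append, pathLength, ih, List.length_cons, Finset.sum_range_succ' _ (l.length + 1),
      add_comm]
    simp only [walkOf_succ_cons, walkOf_zero]

/-- The trajectories from `i` that follow the first return path of `i` with inner nodes `l`. -/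
def returnCylinder (i : Fin n) (l : List (Fin n)) : Set (ℕ → Fin n) :=
  {x | ∀ k ≤ l.length + 1, x k = walkOf i i l k}

lemma markovLaw_returnCylinder {P : Matrix (Fin n) (Fin n) ℝ}
    (hP : (∀ i j, 0 ≤ P i j) ∧ P *ᵥ 1 = 1) {i : Fin n} {l : List (Fin n)} (hl : i ∉ l) :
    markovLaw P i (returnCylinder i l) = ENNReal.ofReal (tabooProb P i i l) := by
  have h := markovLaw_cylinder hP (walkOf i i l) (l.length + 1)
  rw [walkOf_zero] at h
  rw [returnCylinder, h, tabooProb_eq_prod P hl, ENNReal.ofReal_prod_of_nonneg]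
  exact fun k _ => hP.1 _ _

lemma ne_of_mem_returnCylinder {i : Fin n} {l : List (Fin n)} (hl : i ∉ l) {x : ℕ → Fin n}
    (hx : x ∈ returnCylinder i l) {k : ℕ} (h₁ : 1 ≤ k) (h₂ : k ≤ l.length) : x k ≠ i := by
  obtain ⟨k, rfl⟩ := Nat.exists_eq_add_of_le' h₁
  rw [hx _ (by omega), walkOf_succ_of_lt _ _ (by omega)]
  exact fun h => hl (h ▸ List.getElem_mem _)

lemma disjoint_returnCylinder {i : Fin n} {l l' : List (Fin n)} (hl : i ∉ l) (hl' : i ∉ l')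
    (hne : l ≠ l') : Disjoint (returnCylinder i l) (returnCylinder i l') := by
  refine Set.disjoint_left.2 fun x hx hx' => hne ?_
  have hi : x (l.length + 1) = i := by rw [hx _ le_rfl, walkOf_length_succ]
  have hi' : x (l'.length + 1) = i := by rw [hx' _ le_rfl, walkOf_length_succ]
  have hlen : l.length = l'.length := by
    rcases lt_trichotomy l.length l'.length with h | h | h
    · exact absurd hi (ne_of_mem_returnCylinder hl' hx' (by omega) h)
    · exact h
    · exact absurd hi' (ne_of_mem_returnCylinder hl hx (by omega) h)
  refine List.ext_getElem hlen fun k h₁ h₂ => ?_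
  rw [← walkOf_succ_of_lt i i h₁, ← walkOf_succ_of_lt i i h₂, ← hx _ (by omega), ← hx' _ (by omega)]

/-- The infimum defining the hitting time is attained at the first visit, since travel times are
nonnegative. -/
lemma WeightedDigraph.hittingTime_eq_of_first_visit (G : WeightedDigraph n) {i : Fin n}
    {x : ℕ → Fin n} {m : ℕ} (hm : x (m + 1) = i) (hlt : ∀ k, 1 ≤ k → k ≤ m → x k ≠ i) :
    G.hittingTime i x =
      ((∑ k ∈ Finset.range (m + 1), G.w (x k) (x (k + 1)) : ℕ) : ℕ∞) := by
  refine IsLeast.csInf_eq ⟨⟨m + 1, by omega, hm, rfl⟩, ?_⟩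
  rintro t ⟨k, hk, hki, rfl⟩
  have hmk : m + 1 ≤ k := by
    by_contra h
    exact hlt k hk (by omega) hki
  exact Nat.cast_le.2 (Finset.sum_le_sum_of_subset (Finset.range_mono hmk))

lemma WeightedDigraph.hittingTime_of_mem_returnCylinder (G : WeightedDigraph n) {i : Fin n}
    {l : List (Fin n)} (hl : i ∉ l) {x : ℕ → Fin n} (hx : x ∈ returnCylinder i l) :
    G.hittingTime i x = (G.pathLength (i :: (l ++ [i])) : ℕ∞) := by
  rw [G.hittingTime_eq_of_first_visit (m := l.length) (by rw [hx _ le_rfl, walkOf_length_succ])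
    (fun k h₁ h₂ => ne_of_mem_returnCylinder hl hx h₁ h₂), G.pathLength_eq_sum]
  congr 1
  refine Finset.sum_congr rfl fun k hk => ?_
  rw [Finset.mem_range] at hk
  rw [hx k (by omega), hx (k + 1) (by omega)]

lemma exists_mem_returnCylinder {i : Fin n} {x : ℕ → Fin n} (h0 : x 0 = i)
    (h : ∃ k, 1 ≤ k ∧ x k = i) : ∃ l, i ∉ l ∧ x ∈ returnCylinder i l := by
  classical
  obtain ⟨m, hm⟩ := Nat.exists_eq_add_of_le' (Nat.find_spec h).1
  have hmi : x (m + 1) = i := hm ▸ (Nat.find_spec h).2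
  have hlt : ∀ k, 1 ≤ k → k ≤ m → x k ≠ i := fun k h₁ h₂ hk =>
    Nat.find_min h (m := k) (by omega) ⟨h₁, hk⟩
  refine ⟨List.ofFn fun k : Fin m => x (k + 1), ?_, ?_⟩
  · rw [List.mem_ofFn]
    rintro ⟨k, hk⟩
    exact hlt (k + 1) (by omega) (by omega) hk
  · rintro (_ | k) hk
    · rw [walkOf_zero, h0]
    rw [List.length_ofFn] at hk
    rcases Nat.lt_or_ge k m with hkm | hkm
    · rw [walkOf_succ_of_lt _ _ (by simpa using hkm), List.getElem_ofFn]
    · obtain rfl : k = m := by omega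
      have := walkOf_length_succ i i (List.ofFn fun j : Fin k => x (j + 1))
      rw [List.length_ofFn] at this
      rw [this, hmi]

/-- The return time takes the value `k` with the total probability of the first return paths of
length `k`. -/
lemma WeightedDigraph.ofReal_hittingProb (G : WeightedDigraph n) {P : Matrix (Fin n) (Fin n) ℝ}
    (hP : (∀ i j, 0 ≤ P i j) ∧ P *ᵥ 1 = 1) (i : Fin n) (k : ℕ) :
    ENNReal.ofReal (G.hittingProb P k i i) =
      ∑' l : List (Fin n), if G.pathLength (i :: (l ++ [i])) = k then
        ENNReal.ofReal (tabooProb P i i l) else 0 := by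
  classical
  have hstart : ∀ᵐ x ∂markovLaw P i, x 0 = i := by
    have h := markovLaw_cylinder hP (fun _ => i) 0
    simp only [Finset.range_zero, Finset.prod_empty] at h
    have hmem : ∀ᵐ x ∂markovLaw P i, x ∈ {x : ℕ → Fin n | ∀ k ≤ 0, x k = i} :=
      (mem_ae_iff_prob_eq_one (measurableSet_cylinder_eq (fun _ => i) 0)).2 h
    exact hmem.mono fun x hx => hx 0 le_rfl
  let C : List (Fin n) → Set (ℕ → Fin n) := fun l =>
    if i ∉ l ∧ G.pathLength (i :: (l ++ [i])) = k then returnCylinder i l else ∅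
  have hC : markovLaw P i {x | G.hittingTime i x = (k : ℕ∞)} = markovLaw P i (⋃ l, C l) := by
    refine measure_congr ?_
    filter_upwards [hstart] with x hx
    refine propext ⟨fun hk => ?_, fun hk => ?_⟩
    · have hk : G.hittingTime i x = (k : ℕ∞) := hk
      have hex : ∃ k, 1 ≤ k ∧ x k = i := by
        by_contra hne
        have : G.hittingTime i x = ⊤ := by
          rw [hittingTime, sInf_eq_top]
          rintro t ⟨k, h₁, h₂, -⟩
          exact absurd ⟨k, h₁, h₂⟩ hne
        rw [this] at hk
        exact ENat.top_ne_natCast k hk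
      obtain ⟨l, hl, hxl⟩ := exists_mem_returnCylinder hx hex
      rw [G.hittingTime_of_mem_returnCylinder hl hxl, Nat.cast_inj] at hk
      refine Set.mem_iUnion.2 ⟨l, ?_⟩
      simpa only [C, if_pos (And.intro hl hk)] using hxl
    · obtain ⟨l, hxl⟩ := Set.mem_iUnion.1 hk
      by_cases hl : i ∉ l ∧ G.pathLength (i :: (l ++ [i])) = k
      · simp only [C, if_pos hl] at hxl
        change G.hittingTime i x = (k : ℕ∞)
        rw [G.hittingTime_of_mem_returnCylinder hl.1 hxl, hl.2]
      · simp only [C, if_neg hl, Set.mem_empty_iff_false] at hxl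
  rw [hittingProb, ofReal_measureReal, hC, measure_iUnion]
  · refine tsum_congr fun l => ?_
    by_cases hl : i ∈ l
    · simp [C, hl, tabooProb_eq_zero_of_mem]
    · by_cases hk : G.pathLength (i :: (l ++ [i])) = k
      · simp only [C, hl, hk, not_false_eq_true, and_self, if_true,
          markovLaw_returnCylinder hP hl]
      · simp [C, hk]
  · intro l l' hne
    change Disjoint (C l) (C l')
    by_cases hl : i ∉ l ∧ G.pathLength (i :: (l ++ [i])) = k
    · by_cases hl' : i ∉ l' ∧ G.pathLength (i :: (l' ++ [i])) = k
      · simpa only [C, if_pos hl, if_pos hl'] using disjoint_returnCylinder hl.1 hl'.1 hne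
      · simp only [C, if_neg hl', Set.disjoint_empty]
    · simp only [C, if_neg hl, Set.empty_disjoint]
  · intro l
    by_cases hl : i ∉ l ∧ G.pathLength (i :: (l ++ [i])) = k
    · simp only [C, if_pos hl]
      exact measurableSet_cylinder_eq _ _
    · simp only [C, if_neg hl, MeasurableSet.empty]

end TabooPaths

/-! ### Series over lists -/

section ListSeries

variable {α : Type*}

lemma ENNReal.tsum_list [Fintype α] (f : List α → ENNReal) :
    ∑' l, f l = f [] + ∑ k, ∑' l, f (k :: l) := by
  classical
  rw [ENNReal.tsum_eq_add_tsum_ite []]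
  congr 1
  have hinj : Function.Injective fun q : α × List α => q.1 :: q.2 := by
    rintro ⟨a, l⟩ ⟨b, m⟩ h
    simpa using h
  rw [← hinj.tsum_eq, ENNReal.tsum_prod', tsum_fintype]
  · simp
  · intro l hl
    cases l with
    | nil => simp at hl
    | cons a l => exact ⟨(a, l), rfl⟩

/-- The part of a series over lists that comes from the lists of length less than `M`. -/
noncomputable def truncSum (f : List α → ENNReal) (M : ℕ) : ENNReal :=
  ∑' l, if l.length < M then f l else 0

lemma truncSum_zero (f : List α → ENNReal) : truncSum f 0 = 0 := by simp [truncSum]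

lemma truncSum_succ [Fintype α] (f : List α → ENNReal) (M : ℕ) :
    truncSum f (M + 1) = f [] + ∑ k, truncSum (fun l => f (k :: l)) M := by
  rw [truncSum, ENNReal.tsum_list]
  simp [truncSum]

lemma monotone_truncSum (f : List α → ENNReal) : Monotone (truncSum f) := by
  intro M N h
  refine ENNReal.tsum_le_tsum fun l => ?_
  split_ifs with h₁ h₂
  · exact le_rfl
  · omega
  · exact zero_le
  · exact le_rfl

lemma tsum_le_of_truncSum_le {f : List α → ENNReal} {C : ENNReal} (h : ∀ M, truncSum f M ≤ C) :
    ∑' l, f l ≤ C := by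
  rw [ENNReal.tsum_eq_iSup_sum]
  refine iSup_le fun s => le_trans ?_ (h (s.sup List.length + 1))
  refine le_trans (le_of_eq (Finset.sum_congr rfl fun l hl => ?_)) (ENNReal.sum_le_tsum s)
  rw [if_pos (Nat.lt_succ_of_le (Finset.le_sup hl))]

end ListSeries

/-! ### Taboo recursions weighted by a stationary vector -/

section Stationary

variable {ι : Type*} [Fintype ι] {p : ι → ι → ENNReal} {w : ι → ENNReal}

lemma sum_mul_sum_of_stationary (hw : ∀ k, ∑ j, w j * p j k = w k) (v : ι → ENNReal) :
    ∑ j, w j * ∑ k, p j k * v k = ∑ k, w k * v k := by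
  simp_rw [Finset.mul_sum]
  rw [Finset.sum_comm]
  refine Finset.sum_congr rfl fun k _ => ?_
  rw [← hw k, Finset.sum_mul]
  exact Finset.sum_congr rfl fun j _ => (mul_assoc _ _ _).symm

variable [DecidableEq ι]

lemma sum_mul_eq_add_sum_ite (i : ι) (u : ι → ENNReal) :
    ∑ k, w k * u k = w i * u i + ∑ k, w k * (if k = i then 0 else u k) := by
  rw [← Finset.add_sum_erase _ _ (Finset.mem_univ i),
    ← Finset.add_sum_erase _ (fun k => w k * (if k = i then 0 else u k)) (Finset.mem_univ i)]
  simp only [if_true, mul_zero, zero_add]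
  congr 1
  exact Finset.sum_congr rfl fun k hk => by rw [if_neg (Finset.ne_of_mem_erase hk)]

/-- Weighting the taboo recursion by the stationary vector `w` cancels all nodes but `i`. -/
lemma mul_eq_of_taboo_recursion (hw : ∀ k, ∑ j, w j * p j k = w k) (hw_top : ∀ k, w k ≠ ⊤)
    {i : ι} {c u : ι → ENNReal} (hu_top : ∀ k, u k ≠ ⊤)
    (hu : ∀ j, u j = c j + ∑ k, p j k * (if k = i then 0 else u k)) :
    w i * u i = ∑ j, w j * c j := by
  have h : ∑ j, w j * u j =
      ∑ j, w j * c j + ∑ k, w k * (if k = i then 0 else u k) := by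
    rw [← sum_mul_sum_of_stationary hw (fun k => if k = i then 0 else u k),
      ← Finset.sum_add_distrib]
    exact Finset.sum_congr rfl fun j _ => by rw [← mul_add, ← hu j]
  rw [sum_mul_eq_add_sum_ite i] at h
  refine (ENNReal.add_left_inj (ENNReal.sum_ne_top.2 fun k _ => ENNReal.mul_ne_top (hw_top k) ?_)).1 h
  split_ifs
  exacts [ENNReal.zero_ne_top, hu_top k]

/-- The inequality form of `mul_eq_of_taboo_recursion` for the truncations `u M` of a possibly
infinite solution. -/
lemma mul_le_of_taboo_recursion (hw : ∀ k, ∑ j, w j * p j k = w k) (hw_top : ∀ k, w k ≠ ⊤)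
    (hp_top : ∀ j k, p j k ≠ ⊤) {i : ι} {c : ι → ENNReal} (hc_top : ∀ k, c k ≠ ⊤)
    {u : ℕ → ι → ENNReal} (hmono : ∀ k, Monotone fun M => u M k) (h0 : ∀ k, u 0 k = 0)
    (hu : ∀ M j, u (M + 1) j ≤ c j + ∑ k, p j k * (if k = i then 0 else u M k)) (M : ℕ) :
    w i * u M i ≤ ∑ j, w j * c j := by
  have hu_top : ∀ M k, u M k ≠ ⊤ := by
    intro M
    induction M with
    | zero => exact fun k => by rw [h0]; exact ENNReal.zero_ne_top
    | succ M ih =>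
      refine fun k => ne_top_of_le_ne_top (ENNReal.add_ne_top.2 ⟨hc_top k, ?_⟩) (hu M k)
      refine ENNReal.sum_ne_top.2 fun l _ => ENNReal.mul_ne_top (hp_top k l) ?_
      split_ifs
      exacts [ENNReal.zero_ne_top, ih l]
  cases M with
  | zero => rw [h0, mul_zero]; exact zero_le
  | succ M =>
    have h : ∑ j, w j * u (M + 1) j ≤
        ∑ j, w j * c j + ∑ k, w k * (if k = i then 0 else u (M + 1) k) := by
      rw [← sum_mul_sum_of_stationary hw (fun k => if k = i then 0 else u (M + 1) k),
        ← Finset.sum_add_distrib]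
      refine Finset.sum_le_sum fun j _ => ?_
      rw [← mul_add]
      refine mul_le_mul_right ((hu M j).trans (add_le_add le_rfl ?_)) _
      refine Finset.sum_le_sum fun k _ => mul_le_mul_right ?_ _
      split_ifs
      exacts [le_rfl, hmono k M.le_succ]
    rw [sum_mul_eq_add_sum_ite i] at h
    refine (ENNReal.add_le_add_iff_right
      (ENNReal.sum_ne_top.2 fun k _ => ENNReal.mul_ne_top (hw_top k) ?_)).1 h
    split_ifs
    exacts [ENNReal.zero_ne_top, hu_top _ k]

end Stationary

/-! ### The entropy of the first return path -/

section ReturnPathEntropy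

variable {n : ℕ}

lemma tabooProb_nonneg {P : Matrix (Fin n) (Fin n) ℝ} (hP : ∀ i j, 0 ≤ P i j) (i j : Fin n)
    (l : List (Fin n)) : 0 ≤ tabooProb P i j l := by
  induction l generalizing j with
  | nil => exact hP j i
  | cons k l ih =>
    rw [tabooProb]
    split_ifs
    exacts [le_rfl, mul_nonneg (hP j k) (ih k)]

lemma le_one_of_stochastic {P : Matrix (Fin n) (Fin n) ℝ}
    (hP : (∀ i j, 0 ≤ P i j) ∧ P *ᵥ 1 = 1) (i j : Fin n) : P i j ≤ 1 := by
  have h := congrFun hP.2 i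
  simp only [Matrix.mulVec, dotProduct, Pi.one_apply, mul_one] at h
  rw [← h]
  exact Finset.single_le_sum (f := fun j => P i j) (fun k _ => hP.1 i k) (Finset.mem_univ j)

lemma tabooProb_le_one {P : Matrix (Fin n) (Fin n) ℝ}
    (hP : (∀ i j, 0 ≤ P i j) ∧ P *ᵥ 1 = 1) (i j : Fin n) (l : List (Fin n)) :
    tabooProb P i j l ≤ 1 := by
  induction l generalizing j with
  | nil => exact le_one_of_stochastic hP j i
  | cons k l ih =>
    rw [tabooProb]
    split_ifs
    · exact zero_le_one
    · exact mul_le_one₀ (le_one_of_stochastic hP j k) (tabooProb_nonneg hP.1 i k l) (ih k)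

lemma sum_ofReal_eq_one {P : Matrix (Fin n) (Fin n) ℝ}
    (hP : (∀ i j, 0 ≤ P i j) ∧ P *ᵥ 1 = 1) (i : Fin n) :
    ∑ j, ENNReal.ofReal (P i j) = 1 := by
  have h := congrFun hP.2 i
  simp only [Matrix.mulVec, dotProduct, Pi.one_apply, mul_one] at h
  rw [← ENNReal.ofReal_sum_of_nonneg fun j _ => hP.1 i j, h, ENNReal.ofReal_one]

lemma sum_ofReal_mul_eq {P : Matrix (Fin n) (Fin n) ℝ} (hP : ∀ i j, 0 ≤ P i j) {π : Fin n → ℝ}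
    (hπ : ∀ i, 0 ≤ π i) (hst : π ᵥ* P = π) (k : Fin n) :
    ∑ j, ENNReal.ofReal (π j) * ENNReal.ofReal (P j k) = ENNReal.ofReal (π k) := by
  have h := congrFun hst k
  simp only [Matrix.vecMul, dotProduct] at h
  rw [← h, ENNReal.ofReal_sum_of_nonneg fun j _ => mul_nonneg (hπ j) (hP j k)]
  exact Finset.sum_congr rfl fun j _ => (ENNReal.ofReal_mul (hπ j)).symm

/-- The terms of the series for the hitting probability of `i` from `j`. -/
noncomputable def hitTerm (P : Matrix (Fin n) (Fin n) ℝ) (i j : Fin n) (l : List (Fin n)) :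
    ENNReal := ENNReal.ofReal (tabooProb P i j l)

/-- The terms of the series for the entropy of the path from `j` to its first visit of `i`. -/
noncomputable def entropyTerm (P : Matrix (Fin n) (Fin n) ℝ) (i j : Fin n) (l : List (Fin n)) :
    ENNReal := ENNReal.ofReal (Real.negMulLog (tabooProb P i j l))

lemma hitTerm_cons {P : Matrix (Fin n) (Fin n) ℝ} (hP : ∀ i j, 0 ≤ P i j) (i j k : Fin n)
    (l : List (Fin n)) : hitTerm P i j (k :: l) =
      if k = i then 0 else ENNReal.ofReal (P j k) * hitTerm P i k l := by
  rw [hitTerm, tabooProb]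
  split_ifs
  · exact ENNReal.ofReal_zero
  · exact ENNReal.ofReal_mul (hP j k)

/-- The chain rule for entropy along the first step of a path. -/
lemma entropyTerm_cons {P : Matrix (Fin n) (Fin n) ℝ}
    (hP : (∀ i j, 0 ≤ P i j) ∧ P *ᵥ 1 = 1) (i j k : Fin n) (l : List (Fin n)) :
    entropyTerm P i j (k :: l) = if k = i then 0 else
      hitTerm P i k l * ENNReal.ofReal (Real.negMulLog (P j k)) +
        ENNReal.ofReal (P j k) * entropyTerm P i k l := by
  rw [entropyTerm, tabooProb]
  split_ifs
  · rw [Real.negMulLog_zero, ENNReal.ofReal_zero]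
  · have h₁ := tabooProb_nonneg hP.1 i k l
    have h₂ := Real.negMulLog_nonneg (hP.1 j k) (le_one_of_stochastic hP j k)
    have h₃ := Real.negMulLog_nonneg h₁ (tabooProb_le_one hP i k l)
    rw [Real.negMulLog_mul, ENNReal.ofReal_add (mul_nonneg h₁ h₂) (mul_nonneg (hP.1 j k) h₃),
      ENNReal.ofReal_mul h₁, ENNReal.ofReal_mul (hP.1 j k)]
    rfl

lemma tsum_hitTerm {P : Matrix (Fin n) (Fin n) ℝ} (hP : ∀ i j, 0 ≤ P i j) (i j : Fin n) :
    ∑' l, hitTerm P i j l = ENNReal.ofReal (P j i) +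
      ∑ k, ENNReal.ofReal (P j k) * (if k = i then 0 else ∑' l, hitTerm P i k l) := by
  rw [ENNReal.tsum_list]
  congr 1
  refine Finset.sum_congr rfl fun k _ => ?_
  simp_rw [hitTerm_cons hP]
  split_ifs
  · simp
  · rw [ENNReal.tsum_mul_left]

lemma truncSum_hitTerm_le_one {P : Matrix (Fin n) (Fin n) ℝ}
    (hP : (∀ i j, 0 ≤ P i j) ∧ P *ᵥ 1 = 1) (i j : Fin n) (M : ℕ) :
    truncSum (hitTerm P i j) M ≤ 1 := by
  induction M generalizing j with
  | zero => rw [truncSum_zero]; exact zero_le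
  | succ M ih =>
    have hk : ∀ k, truncSum (fun l => hitTerm P i j (k :: l)) M =
        if k = i then 0 else ENNReal.ofReal (P j k) * truncSum (hitTerm P i k) M := by
      intro k
      simp_rw [truncSum, hitTerm_cons hP.1]
      split_ifs
      · simp
      · simp_rw [← ENNReal.tsum_mul_left, mul_ite, mul_zero]
    rw [truncSum_succ, ← sum_ofReal_eq_one hP j,
      ← Finset.add_sum_erase _ _ (Finset.mem_univ i),
      ← Finset.add_sum_erase Finset.univ (fun k => ENNReal.ofReal (P j k)) (Finset.mem_univ i),
      hk i, if_pos rfl, zero_add]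
    refine add_le_add le_rfl (Finset.sum_le_sum fun k hki => ?_)
    rw [hk k, if_neg (Finset.ne_of_mem_erase hki)]
    exact mul_le_of_le_one_right' (ih k)

lemma tsum_hitTerm_le_one {P : Matrix (Fin n) (Fin n) ℝ}
    (hP : (∀ i j, 0 ≤ P i j) ∧ P *ᵥ 1 = 1) (i j : Fin n) : ∑' l, hitTerm P i j l ≤ 1 :=
  tsum_le_of_truncSum_le (truncSum_hitTerm_le_one hP i j)

/-- Stationarity makes the chain return to `i` almost surely. -/
lemma tsum_hitTerm_self {P : Matrix (Fin n) (Fin n) ℝ}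
    (hP : (∀ i j, 0 ≤ P i j) ∧ P *ᵥ 1 = 1) {π : Fin n → ℝ} (hπ : ∀ i, 0 < π i)
    (hst : π ᵥ* P = π) (i : Fin n) : ∑' l, hitTerm P i i l = 1 := by
  have h := mul_eq_of_taboo_recursion (sum_ofReal_mul_eq hP.1 (fun k => (hπ k).le) hst)
    (fun k => ENNReal.ofReal_ne_top) (fun k => ne_top_of_le_ne_top ENNReal.one_ne_top (tsum_hitTerm_le_one hP i k))
    (fun j => tsum_hitTerm hP.1 i j)
  rw [sum_ofReal_mul_eq hP.1 (fun k => (hπ k).le) hst] at h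
  refine (ENNReal.mul_right_inj (ENNReal.ofReal_pos.2 (hπ i)).ne' ENNReal.ofReal_ne_top).1 ?_
  rw [h, mul_one]

/-- A chain with a positive stationary distribution and all nodes reachable from `i` is recurrent:
from every node it hits `i` almost surely. -/
lemma tsum_hitTerm_eq_one {P : Matrix (Fin n) (Fin n) ℝ}
    (hP : (∀ i j, 0 ≤ P i j) ∧ P *ᵥ 1 = 1) {π : Fin n → ℝ} (hπ : ∀ i, 0 < π i)
    (hst : π ᵥ* P = π) {i j : Fin n} (hreach : Relation.ReflTransGen (fun a b => 0 < P a b) i j) :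
    ∑' l, hitTerm P i j l = 1 := by
  have hle := tsum_hitTerm_le_one hP i
  induction hreach with
  | refl => exact tsum_hitTerm_self hP hπ hst i
  | @tail a b _ hab ih =>
    -- The defects `1 - v k` have mean zero under the step from `a`, so the one at `b` vanishes.
    set v : Fin n → ENNReal := fun k => if k = i then 1 else ∑' l, hitTerm P i k l with hv
    have hv1 : ∀ k, v k ≤ 1 := by
      intro k
      simp only [hv]
      split_ifs
      exacts [le_rfl, hle k]
    have hmean : ∑ k, ENNReal.ofReal (P a k) * v k = 1 := by
      rw [← ih, tsum_hitTerm hP.1, sum_mul_eq_add_sum_ite i]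
      congr 1
      · simp [hv]
      · refine Finset.sum_congr rfl fun k _ => ?_
        simp only [hv]
        split_ifs <;> rfl
    have hsplit : ∑ k, ENNReal.ofReal (P a k) * v k +
        ∑ k, ENNReal.ofReal (P a k) * (1 - v k) = 1 := by
      rw [← Finset.sum_add_distrib]
      refine Eq.trans ?_ (sum_ofReal_eq_one hP a)
      refine Finset.sum_congr rfl fun k _ => ?_
      rw [← mul_add, add_tsub_cancel_of_le (hv1 k), mul_one]
    rw [hmean] at hsplit
    have hzero : ∑ k, ENNReal.ofReal (P a k) * (1 - v k) = 0 :=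
      (ENNReal.add_right_inj ENNReal.one_ne_top).1 (hsplit.trans (add_zero 1).symm)
    have hb := (Finset.sum_eq_zero_iff.1 hzero) b (Finset.mem_univ b)
    rcases mul_eq_zero.1 hb with hb | hb
    · exact absurd hb (ENNReal.ofReal_pos.2 hab).ne'
    have hvb : v b = 1 := le_antisymm (hv1 b) (tsub_eq_zero_iff_le.1 hb)
    by_cases hbi : b = i
    · rw [hbi, tsum_hitTerm_self hP hπ hst i]
    · simpa only [hv, if_neg hbi] using hvb

/-- The entropy of the transition out of `j`. -/
noncomputable def stepEntropy (P : Matrix (Fin n) (Fin n) ℝ) (j : Fin n) : ENNReal :=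
  ∑ k, ENNReal.ofReal (Real.negMulLog (P j k))

lemma tsum_entropyTerm {P : Matrix (Fin n) (Fin n) ℝ}
    (hP : (∀ i j, 0 ≤ P i j) ∧ P *ᵥ 1 = 1) {i : Fin n} (hhit : ∀ j, ∑' l, hitTerm P i j l = 1)
    (j : Fin n) : ∑' l, entropyTerm P i j l = stepEntropy P j +
      ∑ k, ENNReal.ofReal (P j k) * (if k = i then 0 else ∑' l, entropyTerm P i k l) := by
  have hk : ∀ k, ∑' l, entropyTerm P i j (k :: l) =
      (if k = i then 0 else ENNReal.ofReal (Real.negMulLog (P j k))) +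
        ENNReal.ofReal (P j k) * (if k = i then 0 else ∑' l, entropyTerm P i k l) := by
    intro k
    simp_rw [entropyTerm_cons hP]
    split_ifs
    · simp
    · rw [ENNReal.tsum_add, ENNReal.tsum_mul_left, ENNReal.tsum_mul_right, hhit, one_mul]
  rw [ENNReal.tsum_list, Finset.sum_congr rfl fun k _ => hk k, Finset.sum_add_distrib, ← add_assoc,
    stepEntropy]
  congr 1
  simpa [entropyTerm, tabooProb] using (sum_mul_eq_add_sum_ite (w := fun _ => 1) i
    fun k => ENNReal.ofReal (Real.negMulLog (P j k))).symm

lemma truncSum_entropyTerm_succ_le {P : Matrix (Fin n) (Fin n) ℝ}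
    (hP : (∀ i j, 0 ≤ P i j) ∧ P *ᵥ 1 = 1) (i j : Fin n) (M : ℕ) :
    truncSum (entropyTerm P i j) (M + 1) ≤ stepEntropy P j +
      ∑ k, ENNReal.ofReal (P j k) * (if k = i then 0 else truncSum (entropyTerm P i k) M) := by
  have hk : ∀ k, truncSum (fun l => entropyTerm P i j (k :: l)) M ≤
      (if k = i then 0 else ENNReal.ofReal (Real.negMulLog (P j k))) +
        ENNReal.ofReal (P j k) * (if k = i then 0 else truncSum (entropyTerm P i k) M) := by
    intro k
    have hh := truncSum_hitTerm_le_one hP i k M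
    simp_rw [truncSum, entropyTerm_cons hP]
    rw [truncSum] at hh
    split_ifs with hki
    · simp
    · rw [← ENNReal.tsum_mul_left]
      refine le_trans (le_of_eq ?_) (add_le_add (mul_le_of_le_one_left' hh) le_rfl)
      rw [← ENNReal.tsum_mul_right, ← ENNReal.tsum_add]
      refine tsum_congr fun l => ?_
      split_ifs <;> simp
  rw [truncSum_succ]
  refine (add_le_add le_rfl (Finset.sum_le_sum fun k _ => hk k)).trans (le_of_eq ?_)
  rw [Finset.sum_add_distrib, ← add_assoc, stepEntropy]
  congr 1
  simpa [entropyTerm, tabooProb] using (sum_mul_eq_add_sum_ite (w := fun _ => 1) i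
    fun k => ENNReal.ofReal (Real.negMulLog (P j k))).symm

lemma stepEntropy_ne_top (P : Matrix (Fin n) (Fin n) ℝ) (j : Fin n) : stepEntropy P j ≠ ⊤ :=
  ENNReal.sum_ne_top.2 fun _ _ => ENNReal.ofReal_ne_top

lemma tsum_entropyTerm_ne_top {P : Matrix (Fin n) (Fin n) ℝ}
    (hP : (∀ i j, 0 ≤ P i j) ∧ P *ᵥ 1 = 1) {π : Fin n → ℝ} (hπ : ∀ i, 0 < π i)
    (hst : π ᵥ* P = π) {i j : Fin n} (hhit : ∀ j, ∑' l, hitTerm P i j l = 1)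
    (hreach : Relation.ReflTransGen (fun a b => 0 < P a b) i j) :
    ∑' l, entropyTerm P i j l ≠ ⊤ := by
  have hi : ∑' l, entropyTerm P i i l ≠ ⊤ := by
    have hpos : ENNReal.ofReal (π i) ≠ 0 := (ENNReal.ofReal_pos.2 (hπ i)).ne'
    have h := mul_le_of_taboo_recursion (sum_ofReal_mul_eq hP.1 (fun k => (hπ k).le) hst)
      (fun k => ENNReal.ofReal_ne_top) (fun j k => ENNReal.ofReal_ne_top) (i := i)
      (stepEntropy_ne_top P) (u := fun M k => truncSum (entropyTerm P i k) M)
      (fun k => monotone_truncSum _) (fun k => truncSum_zero _)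
      (fun M j => truncSum_entropyTerm_succ_le hP i j M)
    have hfin : ∑ k, ENNReal.ofReal (π k) * stepEntropy P k ≠ ⊤ := ENNReal.sum_ne_top.2 fun k _ =>
      ENNReal.mul_ne_top ENNReal.ofReal_ne_top (stepEntropy_ne_top P k)
    refine ne_top_of_le_ne_top (ENNReal.div_ne_top hfin hpos) (tsum_le_of_truncSum_le fun M => ?_)
    rw [ENNReal.le_div_iff_mul_le (.inl hpos) (.inl ENNReal.ofReal_ne_top), mul_comm]
    exact h M
  induction hreach with
  | refl => exact hi
  | @tail a b _ hab ih =>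
    by_cases hbi : b = i
    · rwa [hbi]
    rw [tsum_entropyTerm hP hhit] at ih
    have h := (ENNReal.sum_ne_top.1 (ENNReal.add_ne_top.1 ih).2) b (Finset.mem_univ b)
    rw [if_neg hbi] at h
    exact (ENNReal.lt_top_of_mul_ne_top_right h (ENNReal.ofReal_pos.2 hab).ne').ne

lemma entropyRate_eq_sum (π : Fin n → ℝ) (P : Matrix (Fin n) (Fin n) ℝ) :
    entropyRate π P = ∑ j, π j * ∑ k, Real.negMulLog (P j k) := by
  simp [entropyRate, Real.negMulLog_eq_neg]

/-- The entropy of the first return path of `i` is the entropy rate divided by `π i`. -/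
lemma hasSum_negMulLog_tabooProb {P : Matrix (Fin n) (Fin n) ℝ}
    (hP : (∀ i j, 0 ≤ P i j) ∧ P *ᵥ 1 = 1) {π : Fin n → ℝ} (hπ : ∀ i, 0 < π i)
    (hst : π ᵥ* P = π) {i : Fin n}
    (hreach : ∀ j, Relation.ReflTransGen (fun a b => 0 < P a b) i j) :
    HasSum (fun l => Real.negMulLog (tabooProb P i i l)) (entropyRate π P / π i) := by
  have hhit := fun j => tsum_hitTerm_eq_one hP hπ hst (hreach j)
  have htop := fun j => tsum_entropyTerm_ne_top hP hπ hst hhit (hreach j)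
  have hnn : ∀ l, 0 ≤ Real.negMulLog (tabooProb P i i l) := fun l =>
    Real.negMulLog_nonneg (tabooProb_nonneg hP.1 i i l) (tabooProb_le_one hP i i l)
  have hnn' : ∀ j k, 0 ≤ Real.negMulLog (P j k) := fun j k =>
    Real.negMulLog_nonneg (hP.1 j k) (le_one_of_stochastic hP j k)
  have hrate : ENNReal.ofReal (π i) * ∑' l, entropyTerm P i i l =
      ENNReal.ofReal (entropyRate π P) := by
    rw [mul_eq_of_taboo_recursion (sum_ofReal_mul_eq hP.1 (fun k => (hπ k).le) hst)
      (fun k => ENNReal.ofReal_ne_top) htop (tsum_entropyTerm hP hhit)]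
    rw [entropyRate_eq_sum, ENNReal.ofReal_sum_of_nonneg fun j _ =>
      mul_nonneg (hπ j).le (Finset.sum_nonneg fun k _ => hnn' j k)]
    refine Finset.sum_congr rfl fun j _ => ?_
    rw [ENNReal.ofReal_mul (hπ j).le, ENNReal.ofReal_sum_of_nonneg fun k _ => hnn' j k, stepEntropy]
  have hsum : Summable fun l => Real.negMulLog (tabooProb P i i l) := by
    refine (ENNReal.summable_toReal (htop i)).congr fun l => ?_
    exact ENNReal.toReal_ofReal (hnn l)
  have htsum : ∑' l, entropyTerm P i i l =
      ENNReal.ofReal (∑' l, Real.negMulLog (tabooProb P i i l)) :=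
    (ENNReal.ofReal_tsum_of_nonneg hnn hsum).symm
  have h0 : 0 ≤ entropyRate π P := by
    rw [entropyRate_eq_sum]
    exact Finset.sum_nonneg fun j _ =>
      mul_nonneg (hπ j).le (Finset.sum_nonneg fun k _ => hnn' j k)
  rw [htsum, ← ENNReal.ofReal_mul (hπ i).le, ENNReal.ofReal_eq_ofReal_iff
    (mul_nonneg (hπ i).le (tsum_nonneg hnn)) h0] at hrate
  rw [← hrate, mul_div_cancel_left₀ _ (hπ i).ne']
  exact hsum.hasSum

end ReturnPathEntropy

/-! ### Entropy under merging of atoms -/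

section Grouping

variable {ι κ : Type*}

lemma hasSum_of_hasSum_fiberwise [DecidableEq κ] {g : ι → ℝ} {φ : ι → κ} {b : κ → ℝ} {T : ℝ}
    (hg : HasSum g T) (hb : ∀ k, HasSum (fun l => if φ l = k then g l else 0) (b k)) :
    HasSum b T := by
  refine ((Equiv.sigmaFiberEquiv φ).hasSum_iff.2 hg).sigma fun k => ?_
  change HasSum (g ∘ ((↑) : {l | φ l = k} → ι)) (b k)
  rw [hasSum_subtype_iff_indicator]
  refine (hb k).congr_fun fun l => ?_
  by_cases h : φ l = k
  · simp [h]
  · simp [h]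

/-- Merging the atoms `f l` according to the value of `φ l` into atoms `q k` does not increase the
entropy, and preserves it only if no two positive atoms are merged. -/
lemma hasSum_negMulLog_fiberwise [DecidableEq κ] {f : ι → ℝ} {φ : ι → κ} {q : κ → ℝ} {S : ℝ}
    (hf : ∀ l, 0 ≤ f l) (hq : ∀ k, HasSum (fun l => if φ l = k then f l else 0) (q k))
    (hq_le : ∀ k, q k ≤ 1) (hS : HasSum (fun l => Real.negMulLog (f l)) S) :
    ∃ T, HasSum (fun k => Real.negMulLog (q k)) T ∧ T ≤ S ∧
      (T = S ↔ ∀ l, f l ≠ 0 → f l = q (φ l)) := by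
  have hfq : ∀ l, f l ≤ q (φ l) := by
    intro l
    refine le_trans (le_of_eq (if_pos rfl).symm) (le_hasSum (hq (φ l)) l fun l' _ => ?_)
    split_ifs
    exacts [hf l', le_rfl]
  -- Each atom keeps its mass but is given the information content of the merged atom.
  have h0 : ∀ l, 0 ≤ f l * -Real.log (q (φ l)) := fun l => mul_nonneg (hf l)
    (neg_nonneg.2 (Real.log_nonpos ((hf l).trans (hfq l)) (hq_le _)))
  have hle : ∀ l, f l * -Real.log (q (φ l)) ≤ Real.negMulLog (f l) := by
    intro l
    rcases (hf l).eq_or_lt with h | h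
    · simp [← h]
    · rw [Real.negMulLog, neg_mul, mul_neg, neg_le_neg_iff]
      exact mul_le_mul_of_nonneg_left (Real.log_le_log h (hfq l)) h.le
  have hT := (Summable.of_nonneg_of_le h0 hle hS.summable).hasSum
  refine ⟨_, hasSum_of_hasSum_fiberwise (φ := φ) hT fun k => ?_, hasSum_le hle hT hS, ?_⟩
  · have h := (hq k).mul_right (-Real.log (q k))
    rw [Real.negMulLog, neg_mul, ← mul_neg]
    refine h.congr_fun fun l => ?_
    split_ifs with hk
    · rw [hk]
    · rw [zero_mul]
  · constructor
    · intro h l hl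
      have hsub := hS.sub hT
      rw [h, sub_self, hasSum_zero_iff_of_nonneg fun l => sub_nonneg.2 (hle l)] at hsub
      have hpos : 0 < f l := lt_of_le_of_ne (hf l) hl.symm
      have hl' := congrFun hsub l
      simp only [Pi.zero_apply, Real.negMulLog, neg_mul, mul_neg] at hl'
      have hlog : Real.log (f l) = Real.log (q (φ l)) := mul_left_cancel₀ hl (by linarith)
      exact Real.log_injOn_pos hpos (hpos.trans_le (hfq l)) hlog
    · intro h
      refine hT.unique (hS.congr_fun fun l => ?_)
      by_cases hl : f l = 0
      · simp [hl]
      · rw [← h l hl, Real.negMulLog, neg_mul, mul_neg]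

/-- An atom is the only positive one in its fiber iff it carries the mass of the fiber. -/
lemma eq_hasSum_fiber_iff [DecidableEq κ] {f : ι → ℝ} {φ : ι → κ} {q : κ → ℝ}
    (hf : ∀ l, 0 ≤ f l) (hq : ∀ k, HasSum (fun l => if φ l = k then f l else 0) (q k)) (l : ι) :
    f l = q (φ l) ↔ ∀ l', l' ≠ l → φ l' = φ l → f l' = 0 := by
  classical
  constructor
  · intro h l' hne hφ
    have hs := sum_le_hasSum {l, l'} (fun i _ => by split_ifs; exacts [hf i, le_rfl]) (hq (φ l))
    rw [Finset.sum_pair hne.symm, if_pos rfl, if_pos hφ] at hs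
    exact le_antisymm (by linarith) (hf l')
  · intro h
    have hs : HasSum (fun l' => if φ l' = φ l then f l' else 0) (f l) := by
      convert hasSum_single l (f := fun l' => if φ l' = φ l then f l' else 0) ?_ using 1
      · rw [if_pos rfl]
      · intro l' hne
        split_ifs with hφ
        exacts [h l' hne hφ, rfl]
    exact hs.unique (hq (φ l))

end Grouping

/-! ### Return time entropy of conforming chains -/

namespace WeightedDigraph

variable {n : ℕ} {G : WeightedDigraph n} {π : Fin n → ℝ} {ε : ℝ} {P : Matrix (Fin n) (Fin n) ℝ}

lemma stochastic_of_mem_conforming (hε : 0 < ε) (hP : P ∈ G.conforming π ε) :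
    (∀ i j, 0 ≤ P i j) ∧ P *ᵥ 1 = 1 := by
  refine ⟨fun i j => ?_, hP.2.2.1⟩
  by_cases h : G.Adj i j
  · exact hε.le.trans (hP.1 i j h)
  · exact (hP.2.1 i j h).ge

lemma pos_iff_adj (hε : 0 < ε) (hP : P ∈ G.conforming π ε) (i j : Fin n) :
    0 < P i j ↔ G.Adj i j := by
  refine ⟨fun h => ?_, fun h => hε.trans_le (hP.1 i j h)⟩
  by_contra hadj
  exact h.ne' (hP.2.1 i j hadj)

lemma tabooProb_pos_iff (hε : 0 < ε) (hP : P ∈ G.conforming π ε) (i j : Fin n)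
    (l : List (Fin n)) :
    0 < tabooProb P i j l ↔ i ∉ l ∧ (j :: (l ++ [i])).IsChain G.Adj := by
  induction l generalizing j with
  | nil => simp [tabooProb, pos_iff_adj hε hP]
  | cons k l ih =>
    rw [tabooProb, List.cons_append, List.isChain_cons_cons, List.mem_cons, not_or]
    split_ifs with hk
    · simp [hk]
    · have hPjk := (stochastic_of_mem_conforming hε hP).1 j k
      have ht := tabooProb_nonneg (stochastic_of_mem_conforming hε hP).1 i k l
      rw [← pos_iff_adj hε hP]
      constructor
      · intro h
        have h₁ := pos_of_mul_pos_left h ht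
        obtain ⟨h₂, h₃⟩ := (ih k).1 (pos_of_mul_pos_right h hPjk)
        exact ⟨⟨Ne.symm hk, h₂⟩, h₁, h₃⟩
      · rintro ⟨⟨-, h₂⟩, h₁, h₃⟩
        exact mul_pos h₁ ((ih k).2 ⟨h₂, h₃⟩)

lemma tabooProb_ne_zero_iff (hε : 0 < ε) (hP : P ∈ G.conforming π ε) (i : Fin n)
    (l : List (Fin n)) :
    tabooProb P i i l ≠ 0 ↔ G.IsFirstReturnPath i (i :: (l ++ [i])) := by
  rw [← (tabooProb_nonneg (stochastic_of_mem_conforming hε hP).1 i i l).lt_iff_ne',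
    tabooProb_pos_iff hε hP]
  constructor
  · exact fun h => ⟨l, rfl, h.1, h.2⟩
  · rintro ⟨l', h, h₁, h₂⟩
    simp only [List.cons.injEq, List.append_cancel_right_eq, true_and] at h
    exact ⟨h ▸ h₁, h₂⟩

lemma IsFirstReturnPath.one_le_pathLength {i : Fin n} {p : List (Fin n)}
    (h : G.IsFirstReturnPath i p) : 1 ≤ G.pathLength p := by
  obtain ⟨l, rfl, -, hc⟩ := h
  cases l with
  | nil =>
    rw [List.nil_append, List.isChain_cons_cons] at hc
    exact (G.one_le_w _ _ hc.1).trans (Nat.le_add_right _ _)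
  | cons k l =>
    rw [List.cons_append, List.isChain_cons_cons] at hc
    exact (G.one_le_w _ _ hc.1).trans (Nat.le_add_right _ _)

lemma reflTransGen_pos (hG : G.StronglyConnected) (hε : 0 < ε) (hP : P ∈ G.conforming π ε)
    (i j : Fin n) : Relation.ReflTransGen (fun a b => 0 < P a b) i j :=
  Relation.ReflTransGen.mono (fun a b h => (pos_iff_adj hε hP a b).2 h) _ _ (hG i j)

lemma hasSum_hittingProb (hε : 0 < ε) (hP : P ∈ G.conforming π ε) (i : Fin n) (k : ℕ) :
    HasSum (fun l => if G.pathLength (i :: (l ++ [i])) = k then tabooProb P i i l else 0)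
      (G.hittingProb P k i i) := by
  have hst := stochastic_of_mem_conforming hε hP
  have hnn : ∀ l, 0 ≤ if G.pathLength (i :: (l ++ [i])) = k then tabooProb P i i l else 0 := by
    intro l
    split_ifs
    exacts [tabooProb_nonneg hst.1 i i l, le_rfl]
  have h := G.ofReal_hittingProb hst i k
  have hite : ∀ l, (if G.pathLength (i :: (l ++ [i])) = k then
      ENNReal.ofReal (tabooProb P i i l) else 0) = ENNReal.ofReal
        (if G.pathLength (i :: (l ++ [i])) = k then tabooProb P i i l else 0) := by
    intro l
    split_ifs
    exacts [rfl, ENNReal.ofReal_zero.symm]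
  simp_rw [hite] at h
  have hsum : Summable fun l =>
      if G.pathLength (i :: (l ++ [i])) = k then tabooProb P i i l else 0 := by
    refine (ENNReal.summable_toReal (h ▸ ENNReal.ofReal_ne_top)).congr fun l => ?_
    exact ENNReal.toReal_ofReal (hnn l)
  rw [← ENNReal.ofReal_tsum_of_nonneg hnn hsum, ENNReal.ofReal_eq_ofReal_iff
    (show 0 ≤ G.hittingProb P k i i from measureReal_nonneg) (tsum_nonneg hnn)] at h
  rw [h]
  exact hsum.hasSum

/-- The return time entropy of a state is at most the entropy `entropyRate π P / π i` of its first
return path, with equality iff its first return paths have different lengths. -/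
lemma hasSum_returnTimeEntropyTerm (hG : G.StronglyConnected) (hπ : ∀ i, 0 < π i) (hε : 0 < ε)
    (hP : P ∈ G.conforming π ε) (i : Fin n) :
    ∃ T, HasSum (G.returnTimeEntropyTerm P i) T ∧ T ≤ entropyRate π P / π i ∧
      (T = entropyRate π P / π i ↔ ∀ p q : List (Fin n), G.IsFirstReturnPath i p →
        G.IsFirstReturnPath i q → p ≠ q → G.pathLength p ≠ G.pathLength q) := by
  have hst := stochastic_of_mem_conforming hε hP
  have hnn := tabooProb_nonneg hst.1 i i
  have hq := hasSum_hittingProb hε hP i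
  obtain ⟨T, hT, hle, heq⟩ := hasSum_negMulLog_fiberwise hnn hq (fun k => measureReal_le_one)
    (hasSum_negMulLog_tabooProb hst hπ hP.2.2.2 (reflTransGen_pos hG hε hP i))
  refine ⟨T, ?_, hle, heq.trans ?_⟩
  · -- No first return path has length zero, so the term of index zero vanishes.
    have h0 : G.hittingProb P 0 i i = 0 := by
      refine (hq 0).unique (hasSum_zero.congr_fun fun l => ?_)
      split_ifs with hl
      · by_contra hne
        have := ((tabooProb_ne_zero_iff hε hP i l).1 hne).one_le_pathLength
        omega
      · rfl
    have h := (hasSum_nat_add_iff' 1).2 hT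
    rw [Finset.sum_range_one, h0, Real.negMulLog_zero, sub_zero] at h
    refine h.congr_fun fun k => ?_
    rw [returnTimeEntropyTerm, Real.negMulLog, neg_mul]
  · simp_rw [eq_hasSum_fiber_iff hnn hq, tabooProb_ne_zero_iff hε hP]
    constructor
    · rintro h p q hp hq' hne hlen
      obtain ⟨l, rfl, -, -⟩ := id hp
      obtain ⟨l', rfl, -, -⟩ := id hq'
      refine (tabooProb_ne_zero_iff hε hP i l').2 hq' (h l hp l' ?_ hlen.symm)
      rintro rfl
      exact hne rfl
    · intro h l hl l' hne hlen
      by_contra hl'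
      refine h _ _ hl ((tabooProb_ne_zero_iff hε hP i l').1 hl') (fun heq => hne ?_) hlen.symm
      simp only [List.cons.injEq, List.append_cancel_right_eq, true_and] at heq
      exact heq.symm

end WeightedDigraph

theorem mainTheorem5 {n : ℕ} (G : WeightedDigraph n) (hG : G.StronglyConnected)
    (π : Fin n → ℝ) (hπ_pos : ∀ i, 0 < π i) (hπ_sum : ∑ i, π i = 1)
    (ε : ℝ) (hε : 0 < ε) :
    (∀ P ∈ G.conforming π ε, ∀ i, Summable (G.returnTimeEntropyTerm P i)) ∧
    (∀ P ∈ G.conforming π ε, G.returnTimeEntropy π P ≤ n * entropyRate π P) ∧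
    (∀ P ∈ G.conforming π ε,
      G.returnTimeEntropy π P = n * entropyRate π P ↔ G.ReturnPathsDistinguishable) ∧
    (G.ReturnPathsDistinguishable →
      argmaxOn (G.returnTimeEntropy π) (G.conforming π ε) =
        argmaxOn (entropyRate π) (G.conforming π ε)) := by
  have hstate : ∀ P ∈ G.conforming π ε, ∀ i,
      π i * G.stateReturnTimeEntropy P i ≤ entropyRate π P ∧
      (π i * G.stateReturnTimeEntropy P i = entropyRate π P ↔ ∀ p q : List (Fin n),
        G.IsFirstReturnPath i p → G.IsFirstReturnPath i q → p ≠ q →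
          G.pathLength p ≠ G.pathLength q) := by
    intro P hP i
    obtain ⟨T, hT, hle, heq⟩ := G.hasSum_returnTimeEntropyTerm hG hπ_pos hε hP i
    rw [WeightedDigraph.stateReturnTimeEntropy, hT.tsum_eq, ← heq, eq_div_iff (hπ_pos i).ne',
      mul_comm]
    exact ⟨(le_div_iff₀ (hπ_pos i)).1 hle, Iff.rfl⟩
  have hconst : ∀ P, (n : ℝ) * entropyRate π P = ∑ _i : Fin n, entropyRate π P := by simp
  have heq : ∀ P ∈ G.conforming π ε,
      G.returnTimeEntropy π P = n * entropyRate π P ↔ G.ReturnPathsDistinguishable := by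
    intro P hP
    rw [hconst, WeightedDigraph.returnTimeEntropy,
      Finset.sum_eq_sum_iff_of_le fun i _ => (hstate P hP i).1]
    exact ⟨fun h i => (hstate P hP i).2.1 (h i (Finset.mem_univ i)),
      fun h i _ => (hstate P hP i).2.2 (h i)⟩
  refine ⟨fun P hP i => ?_, fun P hP => ?_, heq, fun hd => ?_⟩
  · obtain ⟨T, hT, -⟩ := G.hasSum_returnTimeEntropyTerm hG hπ_pos hε hP i
    exact hT.summable
  · rw [hconst]
    exact Finset.sum_le_sum fun i _ => (hstate P hP i).1
  · have hn : 0 < n := by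
      rcases Nat.eq_zero_or_pos n with rfl | h
      · simp at hπ_sum
      · exact h
    ext P
    refine and_congr_right fun hP => forall₂_congr fun Q hQ => ?_
    rw [(heq P hP).2 hd, (heq Q hQ).2 hd]
    exact mul_le_mul_iff_right₀ (Nat.cast_pos.2 hn)
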